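/- There are $n\ge 1$ buttons and $n$ bulbs. A wiring is a matrix $W\in M(n,n;\mathbb F_2)$ with all diagonal entries equal to $1$; $w_{i,j}=1$ means that pressing Button $j$ toggles Bulb $i$, so the number of bulbs toggled by Button $j$ (Bulb $j$ included) is the number of $1$s in column $j$. All bulbs are initially off, and $M(W,0)=\max\{|Wx| : x\in\mathbb F_2^n\}$, where $|u|$ denotes the number of $1$s in $u$, is the maximum number of bulbs that can be lit simultaneously by pressing some combination of buttons. For $m\ge 1$ let $\mu(n,m)$ be the minimum of $M(W,0)$ over all wirings $W$ in which each button toggles at most $m$ bulbs, and, for $n\ge m$, let $\mu^*(n,m)$ be the minimum of $M(W,0)$ over all wirings $W$ in which each button toggles exactly $m$ bulbs. Theorem. Let $n\ge 1$ be an integer. (a) $\mu(n,3)=\mu(n,2)=\lceil 2n/3\rceil$. (b) If $n\ge 3$, then $$\mu^*(n,3)=\begin{cases}4k-1, & n=6k-3 \text{ for some integer } k\ge 1,\\ \mu(n,3), & \text{otherwise.}\end{cases}$$ In the exceptional case $n=6k-3$, $\mu^*(n,3)=\mu(n,3)+1$. -/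

import Mathlib

namespace Wiring

/-- Entry `W i j = 1` means that pressing vertex (button) `j` toggles vertex (bulb) `i`.
`maxLit W c` is the maximum, over all sets `x` of pressed vertices, of the number of lit
vertices `|W x + c|`, where `c` is the initial configuration. -/
def maxLit {n : ℕ} (W : Matrix (Fin n) (Fin n) (ZMod 2)) (c : Fin n → ZMod 2) : ℕ :=
  Finset.univ.sup fun x : Fin n → ZMod 2 => hammingNorm (W.mulVec x + c)

/-- The degree of vertex `j`: the number of ones in column `j`, that is, the number of bulbs
(including bulb `j`) toggled by button `j`. -/
def vertexDegree {n : ℕ} (W : Matrix (Fin n) (Fin n) (ZMod 2)) (j : Fin n) : ℕ :=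
  hammingNorm fun i => W i j

/-- The degree of a wiring: the maximal vertex degree. -/
def degree {n : ℕ} (W : Matrix (Fin n) (Fin n) (ZMod 2)) : ℕ :=
  Finset.univ.sup (vertexDegree W)

/-- `A n m`: the wirings of `n` buttons and bulbs such that button `i` toggles bulb `i` and
every button toggles at most `m` bulbs. -/
def A (n m : ℕ) : Set (Matrix (Fin n) (Fin n) (ZMod 2)) :=
  {W | (∀ i, W i i = 1) ∧ degree W ≤ m}

/-- `AStar n m`: the wirings in `A n m` in which every button toggles exactly `m` bulbs. -/
def AStar (n m : ℕ) : Set (Matrix (Fin n) (Fin n) (ZMod 2)) :=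
  {W | W ∈ A n m ∧ ∀ j, vertexDegree W j = m}

/-- The minimum of `maxLit W 0` over `A n m`; see `isLeast_mu`. -/
noncomputable def mu (n m : ℕ) : ℕ :=
  sInf ((fun W => maxLit W 0) '' A n m)

/-- The minimum of `maxLit W 0` over `AStar n m` (meant for `1 ≤ m ≤ n`);
see `isLeast_muStar`. -/
noncomputable def muStar (n m : ℕ) : ℕ :=
  sInf ((fun W => maxLit W 0) '' AStar n m)

theorem AStar_nonempty {n m : ℕ} (hm : 1 ≤ m) (hmn : m ≤ n) : (AStar n m).Nonempty := by
  have h : ∀ j : Fin n, ∃ s : Finset (Fin n), {j} ⊆ s ∧ s.card = m := fun j =>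
    Finset.exists_superset_card_eq (by simpa using hm) (by simpa using hmn)
  choose s hs hc using h
  have hd : ∀ j, vertexDegree (Matrix.of fun i j => if i ∈ s j then (1 : ZMod 2) else 0) j = m := by
    intro j
    rw [← hc j]
    simp [vertexDegree, hammingNorm]
  refine ⟨Matrix.of fun i j => if i ∈ s j then 1 else 0, ⟨fun i => ?_, ?_⟩, hd⟩
  · have : i ∈ s i := hs i (by simp)
    simp [this]
  · exact Finset.sup_le fun j _ => (hd j).le

theorem A_nonempty {n m : ℕ} (hm : 1 ≤ m) : (A n m).Nonempty := by
  rcases Nat.eq_zero_or_pos n with rfl | hn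
  · exact ⟨1, fun i => i.elim0, by simp [degree]⟩
  · obtain ⟨W, hW⟩ := AStar_nonempty (n := n) le_rfl hn
    exact ⟨W, hW.1.1, hW.1.2.trans hm⟩

theorem isLeast_mu {n m : ℕ} (hm : 1 ≤ m) :
    IsLeast ((fun W => maxLit W 0) '' A n m) (mu n m) :=
  ⟨Nat.sInf_mem ((A_nonempty hm).image _), fun _ h => Nat.sInf_le h⟩

theorem isLeast_muStar {n m : ℕ} (hm : 1 ≤ m) (hmn : m ≤ n) :
    IsLeast ((fun W => maxLit W 0) '' AStar n m) (muStar n m) :=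
  ⟨Nat.sInf_mem ((AStar_nonempty hm hmn).image _), fun _ h => Nat.sInf_le h⟩

end Wiring

/-! Over `ZMod 2`, pressing buttons takes symmetric differences of columns, so `Lit` describes the
attainable lit sets. The lower bounds peel off gadgets: sets `X` in which `k` points can be lit at
will without disturbing the rest of `V`. If `k` is at least two thirds of `X.card`, induction on `V
\ X` applies. A family covering `V` with at most three points per member always has such a gadget
(`exists_lit_two_thirds`), whence `2 * n ≤ 3 * mu n 3`.

For exact degree 3, equality forces `6 ∣ n` (`Tight.six_dvd_card`). Equality forbids every gadget of
ratio above 2/3, even after a maximal disjoint packing of triples has been removed. The triples that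
meet the remaining points then leave pairs there, and these pairs form components of three points.
Exchanging a packed triple for one with a free pair shows that each component is tied to a single
packed triple, and that together they form a six-point block which no other triple crosses. Removing
the block leaves a tight family.

The upper bounds come from disjoint unions of small explicit wirings. When `n = 6k - 3`, the integer
`2n/3` is excluded by the strict inequality, which costs one extra bulb. -/

namespace Wiring

/-! ### Lit sets, gadgets and the two-thirds bound -/

section Lit

variable {ι : Type*} [DecidableEq ι]

/-- The sets obtained as iterated symmetric differences of members of `F`. -/
inductive Lit (F : Finset (Finset ι)) : Finset ι → Prop
  | empty : Lit F ∅
  | step {c S : Finset ι} : Lit F c → S ∈ F → Lit F (symmDiff c S)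

theorem Lit.mono {F G : Finset (Finset ι)} (h : F ⊆ G) {c : Finset ι} (hc : Lit F c) :
    Lit G c := by
  induction hc with
  | empty => exact .empty
  | step _ hS ih => exact ih.step (h hS)

theorem Lit.mem_iff_of_twins {F : Finset (Finset ι)} {p q : ι}
    (h : ∀ S ∈ F, (p ∈ S ↔ q ∈ S)) {c : Finset ι} (hc : Lit F c) : p ∈ c ↔ q ∈ c := by
  induction hc with
  | empty => simp
  | step _ hS ih => simp only [Finset.mem_symmDiff, ih, h _ hS]

/-- Any lit set can be changed into one that agrees with it on `V \ X` and contains at least `k`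
points of `X`. -/
def Gadget (F : Finset (Finset ι)) (V X : Finset ι) (k : ℕ) : Prop :=
  X ⊆ V ∧ ∀ c, Lit F c → ∃ c', Lit F c' ∧ (∀ x ∈ V, x ∉ X → (x ∈ c' ↔ x ∈ c)) ∧
    k ≤ (c' ∩ X).card

theorem Gadget.extend {F : Finset (Finset ι)} {V X : Finset ι} {k : ℕ} (h : Gadget F V X k)
    {c : Finset ι} (hc : Lit F c) :
    ∃ c', Lit F c' ∧ (c ∩ (V \ X)).card + k ≤ (c' ∩ V).card := by
  obtain ⟨hX, h⟩ := h
  obtain ⟨c', hc', hag, hk⟩ := h c hc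
  refine ⟨c', hc', ?_⟩
  have hd : Disjoint (c ∩ (V \ X)) (c' ∩ X) := by
    rw [Finset.disjoint_left]
    intro x hx hx'
    simp only [Finset.mem_inter, Finset.mem_sdiff] at hx hx'
    exact hx.2.2 hx'.2
  have hsub : (c ∩ (V \ X)) ∪ (c' ∩ X) ⊆ c' ∩ V := by
    intro x hx
    simp only [Finset.mem_union, Finset.mem_inter, Finset.mem_sdiff] at hx ⊢
    rcases hx with ⟨h1, h2, h3⟩ | ⟨h1, h2⟩
    · exact ⟨(hag x h2 h3).2 h1, h2⟩
    · exact ⟨h1, hX h2⟩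
  have := Finset.card_le_card hsub
  rw [Finset.card_union_of_disjoint hd] at this
  omega

theorem mem_iff_of_inter_eq {S V X : Finset ι} (h : S ∩ V = X) {x : ι} (hx : x ∈ V) :
    x ∈ S ↔ x ∈ X := by
  rw [← h, Finset.mem_inter]; tauto

theorem subset_of_inter_eq {S V X : Finset ι} (h : S ∩ V = X) : X ⊆ V :=
  h ▸ Finset.inter_subset_right

theorem card_inter_eq_sum (c X : Finset ι) :
    (c ∩ X).card = ∑ x ∈ X, if x ∈ c then 1 else 0 := by
  rw [Finset.inter_comm, ← Finset.filter_mem_eq_inter, Finset.card_filter]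

theorem gadget_singleton {F : Finset (Finset ι)} {V S : Finset ι} {p : ι} (hS : S ∈ F)
    (h : S ∩ V = {p}) : Gadget F V {p} 1 := by
  refine ⟨subset_of_inter_eq h, fun c hc => ?_⟩
  have hp : p ∈ S := by
    have : p ∈ S ∩ V := by simp [h]
    exact (Finset.mem_inter.1 this).1
  by_cases hpc : p ∈ c
  · exact ⟨c, hc, by simp, by simp [hpc]⟩
  · refine ⟨_, hc.step hS, fun x hx hxp => ?_, ?_⟩
    · have := mem_iff_of_inter_eq h hx
      simp only [Finset.mem_symmDiff]; tauto
    · simp [Finset.mem_symmDiff, hpc, hp]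

/-- No member separates `p` from `q`, so they are always both on or both off, and one toggle of `S`
lights both. -/
theorem gadget_twins {F : Finset (Finset ι)} {V S : Finset ι} {p q : ι} (hS : S ∈ F)
    (h : S ∩ V = {p, q}) (hpq : p ≠ q) (ht : ∀ R ∈ F, (p ∈ R ↔ q ∈ R)) :
    Gadget F V {p, q} 2 := by
  have hV := subset_of_inter_eq h
  refine ⟨hV, fun c hc => ?_⟩
  have hp : p ∈ S := (mem_iff_of_inter_eq h (hV (by simp))).2 (by simp)
  have hq : q ∈ S := (mem_iff_of_inter_eq h (hV (by simp))).2 (by simp)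
  have hcc := hc.mem_iff_of_twins ht
  by_cases hpc : p ∈ c
  · exact ⟨c, hc, by simp, by simp [hpq, hpc, hcc.1 hpc]⟩
  · refine ⟨_, hc.step hS, fun x hx hxp => ?_, ?_⟩
    · have := mem_iff_of_inter_eq h hx
      simp only [Finset.mem_symmDiff]; tauto
    · simp [Finset.mem_symmDiff, hpc, hp, hq, hpq, ← hcc]

/-- Toggling `S` complements the lit part of the triple, and one of the two complementary parts has
at least two points. -/
theorem gadget_triple {F : Finset (Finset ι)} {V S : Finset ι} (hS : S ∈ F)
    (h : (S ∩ V).card = 3) : Gadget F V (S ∩ V) 2 := by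
  refine ⟨Finset.inter_subset_right, fun c hc => ?_⟩
  by_cases hk : 2 ≤ (c ∩ (S ∩ V)).card
  · exact ⟨c, hc, by simp, hk⟩
  · refine ⟨_, hc.step hS, fun x hx hxp => ?_, ?_⟩
    · simp only [Finset.mem_inter] at hxp
      simp only [Finset.mem_symmDiff]; tauto
    · have he : symmDiff c S ∩ (S ∩ V) = (S ∩ V) \ (c ∩ (S ∩ V)) := by
        ext x; simp only [Finset.mem_symmDiff, Finset.mem_inter, Finset.mem_sdiff]; tauto
      rw [he, Finset.card_sdiff_of_subset Finset.inter_subset_right]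
      omega

/-- Toggling a member of `F`, or not, according to `b`. -/
theorem Lit.toggle {F : Finset (Finset ι)} {V S X : Finset ι} {c : Finset ι} (hc : Lit F c)
    (hS : S ∈ F) (h : S ∩ V = X) (b : Prop) :
    ∃ c', Lit F c' ∧ ∀ x ∈ V, (x ∈ c' ↔ ¬ (x ∈ c ↔ (b ∧ x ∈ X))) := by
  by_cases hb : b
  · refine ⟨_, hc.step hS, fun x hx => ?_⟩
    have := mem_iff_of_inter_eq h hx
    simp only [Finset.mem_symmDiff]; tauto
  · exact ⟨c, hc, fun x hx => by simp [hb]⟩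

theorem gadget_path {F : Finset (Finset ι)} {V S R : Finset ι} {p q r : ι} (hS : S ∈ F)
    (hR : R ∈ F) (hSV : S ∩ V = {p, q}) (hRV : R ∩ V = {q, r})
    (hpq : p ≠ q) (hpr : p ≠ r) : Gadget F V {p, q, r} 2 := by
  have hV1 := subset_of_inter_eq hSV
  have hV2 := subset_of_inter_eq hRV
  have hp : p ∈ V := hV1 (by simp)
  have hq : q ∈ V := hV1 (by simp)
  have hr : r ∈ V := hV2 (by simp)
  refine ⟨by simp [Finset.insert_subset_iff, *], fun c hc => ?_⟩
  -- `S` settles the end `p`, then `R`, which misses `p`, settles the end `r`; the middle point `q`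
  -- is sacrificed.
  obtain ⟨c1, hc1, h1⟩ := hc.toggle hS hSV (p ∉ c)
  obtain ⟨c2, hc2, h2⟩ := hc1.toggle hR hRV (r ∉ c1)
  refine ⟨c2, hc2, fun y hy hyX => ?_, ?_⟩
  · simp only [Finset.mem_insert, Finset.mem_singleton, not_or] at hyX
    obtain ⟨n1, n2, n3⟩ := hyX
    simp [h2 y hy, h1 y hy, n1, n2, n3]
  · have e1 : p ∈ c1 := by simp [h1 p hp]
    have e2 : p ∈ c2 := by simp [h2 p hp, e1, hpq, hpr]
    have f2 : r ∈ c2 := by simp [h2 r hr]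
    have : {p, r} ⊆ c2 ∩ {p, q, r} := by simp [Finset.insert_subset_iff, e2, f2]
    simpa [hpr] using Finset.card_le_card this

/-- Three pairs forming a spanning tree on `{p, q, r, s}`. -/
theorem gadget_tree {F : Finset (Finset ι)} {V S R Q : Finset ι} {p q r s x : ι} (hS : S ∈ F)
    (hR : R ∈ F) (hQ : Q ∈ F) (hSV : S ∩ V = {p, q}) (hRV : R ∩ V = {q, r})
    (hQV : Q ∩ V = {x, s}) (hx : x = p ∨ x = q ∨ x = r)
    (hpq : p ≠ q) (hqr : q ≠ r) (hpr : p ≠ r) (hsp : s ≠ p) (hsq : s ≠ q) (hsr : s ≠ r) :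
    Gadget F V {p, q, r, s} 3 := by
  have hV1 := subset_of_inter_eq hSV
  have hV2 := subset_of_inter_eq hRV
  have hV3 := subset_of_inter_eq hQV
  have hp : p ∈ V := hV1 (by simp)
  have hq : q ∈ V := hV1 (by simp)
  have hr : r ∈ V := hV2 (by simp)
  have hs : s ∈ V := hV3 (by simp)
  refine ⟨by simp [Finset.insert_subset_iff, *], fun c hc => ?_⟩
  -- `Q` goes first because it may disturb `p` or `r`, whereas `S` and `R` never touch `s`.
  obtain ⟨c1, hc1, h1⟩ := hc.toggle hQ hQV (s ∉ c)
  obtain ⟨c2, hc2, h2⟩ := hc1.toggle hS hSV (p ∉ c1)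
  obtain ⟨c3, hc3, h3⟩ := hc2.toggle hR hRV (r ∉ c2)
  refine ⟨c3, hc3, fun y hy hyX => ?_, ?_⟩
  · simp only [Finset.mem_insert, Finset.mem_singleton, not_or] at hyX
    obtain ⟨n1, n2, n3, n4⟩ := hyX
    have n5 : y ≠ x := by rcases hx with rfl | rfl | rfl <;> assumption
    simp [h3 y hy, h2 y hy, h1 y hy, n1, n2, n3, n4, n5]
  · have e1 : s ∈ c1 := by simp [h1 s hs]
    have e2 : s ∈ c2 := by simp [h2 s hs, e1, hsp, hsq]
    have e3 : s ∈ c3 := by simp [h3 s hs, e2, hsq, hsr]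
    have f2 : p ∈ c2 := by simp [h2 p hp]
    have f3 : p ∈ c3 := by simp [h3 p hp, f2, hpq, hpr]
    have g3 : r ∈ c3 := by simp [h3 r hr]
    have : {p, r, s} ⊆ c3 ∩ {p, q, r, s} := by simp [Finset.insert_subset_iff, e3, f3, g3]
    have h3 : ({p, r, s} : Finset ι).card = 3 := Finset.card_eq_three.2
      ⟨p, r, s, hpr, hsp.symm, hsr.symm, rfl⟩
    exact h3.symm.le.trans (Finset.card_le_card this)

theorem gadget_two_triples {F : Finset (Finset ι)} {V : Finset ι} {a b c d : ι}
    (hS : {a, b, c} ∈ F) (hR : {a, b, d} ∈ F) (hSV : {a, b, c} ⊆ V) (hRV : {a, b, d} ⊆ V)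
    (hab : a ≠ b) (hac : a ≠ c) (had : a ≠ d) (hbc : b ≠ c) (hbd : b ≠ d) (hcd : c ≠ d) :
    Gadget F V {a, b, c, d} 3 := by
  have ha : a ∈ V := hSV (by simp)
  have hb : b ∈ V := hSV (by simp)
  have hc : c ∈ V := hSV (by simp)
  have hd : d ∈ V := hRV (by simp)
  refine ⟨by simp [Finset.insert_subset_iff, *], fun l hl => ?_⟩
  have key : ∀ c' : Finset ι, (c' ∩ {a, b, c, d}).card =
      (if a ∈ c' then 1 else 0) + ((if b ∈ c' then 1 else 0) + ((if c ∈ c' then 1 else 0) +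
        (if d ∈ c' then 1 else 0))) := by
    intro c'
    rw [card_inter_eq_sum, Finset.sum_insert (by simp [hab, hac, had]),
      Finset.sum_insert (by simp [hbc, hbd]), Finset.sum_insert (by simp [hcd]),
      Finset.sum_singleton]
  -- If exactly one of `a`, `b` is on, this persists under both toggles, so `c` and `d` are simply
  -- lit. If both are off, exactly one toggle is made, chosen to leave `c` or `d` on. If both are
  -- on, either nothing is done or, when `c` and `d` are off, both toggles are made.
  obtain ⟨l1, hl1, h1⟩ := hl.toggle hS (Finset.inter_eq_left.2 hSV)
    ((a ∈ l ↔ b ∈ l) ∧ (a ∉ l ∧ c ∉ l ∨ a ∈ l ∧ c ∉ l ∧ d ∉ l ∨ a ∉ l ∧ c ∈ l ∧ d ∈ l) ∨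
      ¬ (a ∈ l ↔ b ∈ l) ∧ c ∉ l)
  obtain ⟨l2, hl2, h2⟩ := hl1.toggle hR (Finset.inter_eq_left.2 hRV)
    ((a ∈ l ↔ b ∈ l) ∧ (a ∉ l ∧ c ∈ l ∧ d ∉ l ∨ a ∈ l ∧ c ∉ l ∧ d ∉ l) ∨
      ¬ (a ∈ l ↔ b ∈ l) ∧ d ∉ l)
  refine ⟨l2, hl2, fun y hy hyX => ?_, ?_⟩
  · simp only [Finset.mem_insert, Finset.mem_singleton, not_or] at hyX
    obtain ⟨n1, n2, n3, n4⟩ := hyX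
    simp [h2 y hy, h1 y hy, n1, n2, n3, n4]
  · have e1 := h1 a ha
    have e2 := h1 b hb
    have e3 := h1 c hc
    have e4 := h1 d hd
    have f1 := h2 a ha
    have f2 := h2 b hb
    have f3 := h2 c hc
    have f4 := h2 d hd
    simp only [Finset.mem_insert, Finset.mem_singleton, true_or, or_true, and_true,
      hac.symm, had.symm, hbc.symm, hbd.symm, hcd, hcd.symm, or_false, and_false, iff_false,
      not_not] at e1 e2 e3 e4 f1 f2 f3 f4
    rw [key, if_congr f1 rfl rfl, if_congr f2 rfl rfl, if_congr f3 rfl rfl, if_congr f4 rfl rfl]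
    simp only [e1, e2, e3, e4]
    clear e1 e2 e3 e4 f1 f2 f3 f4 h1 h2
    by_cases n1 : a ∈ l <;> by_cases n2 : b ∈ l <;> by_cases n3 : c ∈ l <;>
      by_cases n4 : d ∈ l <;> simp only [n1, n2, n3, n4] <;> norm_num

/-- If the members of `F` cover `V` and each has at most three points in `V`, then some lit set
contains at least two thirds of `V`. -/
theorem exists_lit_two_thirds {F : Finset (Finset ι)} (V : Finset ι)
    (h3 : ∀ S ∈ F, (S ∩ V).card ≤ 3) (hcov : ∀ x ∈ V, ∃ S ∈ F, x ∈ S) :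
    ∃ c, Lit F c ∧ 2 * V.card ≤ 3 * (c ∩ V).card := by
  induction hn : V.card using Nat.strong_induction_on generalizing V with
  | _ n ih =>
  subst hn
  have step : ∀ X k, Gadget F V X k → X.Nonempty → 2 * X.card ≤ 3 * k →
      ∃ c, Lit F c ∧ 2 * V.card ≤ 3 * (c ∩ V).card := by
    intro X k hX hne hk
    have hcard := Finset.card_sdiff_add_card_eq_card hX.1
    have hpos := hne.card_pos
    obtain ⟨c, hc, h⟩ := ih (V \ X).card (by omega) (V \ X)
      (fun S hS => (Finset.card_le_card
        (Finset.inter_subset_inter_left Finset.sdiff_subset)).trans (h3 S hS))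
      (fun x hx => hcov x (Finset.sdiff_subset hx)) rfl
    obtain ⟨c', hc', h'⟩ := hX.extend hc
    exact ⟨c', hc', by omega⟩
  by_cases hV : V = ∅
  · exact ⟨∅, .empty, by simp [hV]⟩
  by_cases e3 : ∃ S ∈ F, (S ∩ V).card = 3
  · obtain ⟨S, hS, h⟩ := e3
    exact step _ _ (gadget_triple hS h) (Finset.card_pos.1 (by omega)) (by omega)
  by_cases e1 : ∃ S ∈ F, (S ∩ V).card = 1
  · obtain ⟨S, hS, h⟩ := e1
    obtain ⟨p, hp⟩ := Finset.card_eq_one.1 h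
    exact step _ _ (gadget_singleton hS hp) (by simp) (by simp)
  have two : ∀ S ∈ F, ∀ p ∈ V, p ∈ S → ∃ q, p ≠ q ∧ S ∩ V = {p, q} := by
    intro S hS p hp hpS
    have hne : 0 < (S ∩ V).card := Finset.card_pos.2 ⟨p, by simp [hp, hpS]⟩
    have h2 : (S ∩ V).card = 2 := by
      have := h3 S hS
      have : (S ∩ V).card ≠ 3 := fun h => e3 ⟨S, hS, h⟩
      have : (S ∩ V).card ≠ 1 := fun h => e1 ⟨S, hS, h⟩
      omega
    obtain ⟨x, y, hxy, h⟩ := Finset.card_eq_two.1 h2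
    have : p ∈ S ∩ V := by simp [hp, hpS]
    rw [h, Finset.mem_insert, Finset.mem_singleton] at this
    rcases this with rfl | rfl
    · exact ⟨y, hxy, h⟩
    · exact ⟨x, hxy.symm, by rw [h, Finset.pair_comm]⟩
  obtain ⟨p, hp⟩ := Finset.nonempty_iff_ne_empty.2 hV
  obtain ⟨S, hS, hpS⟩ := hcov p hp
  obtain ⟨q, hpq, hSV⟩ := two S hS p hp hpS
  have hq : q ∈ V := subset_of_inter_eq hSV (by simp)
  -- All nonempty traces on `V` are now pairs: either `p`, `q` are twins, or a pair containing just
  -- one of them completes a path.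
  by_cases ht : ∀ R ∈ F, (p ∈ R ↔ q ∈ R)
  · exact step _ _ (gadget_twins hS hSV hpq ht) (by simp) (by rw [Finset.card_pair hpq]; omega)
  push Not at ht
  obtain ⟨R, hR, h | h⟩ := ht
  · obtain ⟨r, hpr, hRV⟩ := two R hR p hp h.1
    have hqr : q ≠ r := by
      rintro rfl
      exact h.2 ((mem_iff_of_inter_eq hRV hq).2 (by simp))
    rw [Finset.pair_comm] at hSV
    exact step _ _ (gadget_path hS hR hSV hRV hpq.symm hqr) (by simp)
      (by have := Finset.card_le_three (a := q) (b := p) (c := r); omega)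
  · obtain ⟨r, hqr, hRV⟩ := two R hR q hq h.2
    have hpr : p ≠ r := by
      rintro rfl
      exact h.1 ((mem_iff_of_inter_eq hRV hp).2 (by simp))
    exact step _ _ (gadget_path hS hR hSV hRV hpq hpr) (by simp)
      (by have := Finset.card_le_three (a := p) (b := q) (c := r); omega)

end Lit

/-! ### Tight families: the equality case -/

section Tight

variable {ι : Type*} [DecidableEq ι]

/-- Some lit set contains more than two thirds of `V`. -/
def Good (F : Finset (Finset ι)) (V : Finset ι) : Prop :=
  ∃ c, Lit F c ∧ 2 * V.card < 3 * (c ∩ V).card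

theorem Good.extend {F : Finset (Finset ι)} {V X : Finset ι} {k : ℕ} (h : Good F (V \ X))
    (hX : Gadget F V X k) (hk : 2 * X.card ≤ 3 * k) : Good F V := by
  obtain ⟨c, hc, h⟩ := h
  obtain ⟨c', hc', h'⟩ := hX.extend hc
  have := Finset.card_sdiff_add_card_eq_card hX.1
  exact ⟨c', hc', by omega⟩

/-- A single gadget beating two thirds suffices, since the remainder always reaches two thirds. -/
theorem Gadget.good {F : Finset (Finset ι)} {V X : Finset ι} {k : ℕ} (hX : Gadget F V X k)
    (hk : 2 * X.card < 3 * k) (h3 : ∀ S ∈ F, S.card = 3) (hcov : ∀ x ∈ V, ∃ S ∈ F, x ∈ S) :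
    Good F V := by
  obtain ⟨c, hc, h⟩ := exists_lit_two_thirds (F := F) (V \ X)
    (fun S hS => (Finset.card_le_card Finset.inter_subset_left).trans (h3 S hS).le)
    (fun x hx => hcov x (Finset.sdiff_subset hx))
  obtain ⟨c', hc', h'⟩ := hX.extend hc
  have := Finset.card_sdiff_add_card_eq_card hX.1
  exact ⟨c', hc', by omega⟩

/-- The members of `F` are triples covering `V`, and no lit set contains more than two thirds
of `V`. -/
structure Tight (F : Finset (Finset ι)) (V : Finset ι) : Prop where
  card_eq : ∀ S ∈ F, S.card = 3
  subset : ∀ S ∈ F, S ⊆ V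
  cover : ∀ x ∈ V, ∃ S ∈ F, x ∈ S
  not_good : ¬ Good F V

/-- A disjoint subfamily of `F` of maximal size. -/
structure MaxPacking (F D : Finset (Finset ι)) : Prop where
  subset : D ⊆ F
  disjoint : ∀ S ∈ D, ∀ T ∈ D, S ≠ T → Disjoint S T
  max : ∀ D' ⊆ F, (∀ S ∈ D', ∀ T ∈ D', S ≠ T → Disjoint S T) → D'.card ≤ D.card

/-- The points of `V` outside all members of `D`. -/
def free (V : Finset ι) (D : Finset (Finset ι)) : Finset ι := V \ D.biUnion id

theorem mem_free {V : Finset ι} {D : Finset (Finset ι)} {x : ι} :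
    x ∈ free V D ↔ x ∈ V ∧ ∀ T ∈ D, x ∉ T := by
  simp [free]

theorem exists_maxPacking (F : Finset (Finset ι)) : ∃ D, MaxPacking F D := by
  classical
  obtain ⟨D, hD, hmax⟩ := Finset.exists_max_image
    (F.powerset.filter fun D => ∀ S ∈ D, ∀ T ∈ D, S ≠ T → Disjoint S T) Finset.card
    ⟨∅, by simp⟩
  simp only [Finset.mem_filter, Finset.mem_powerset] at hD hmax
  exact ⟨D, hD.1, hD.2, fun D' h h' => hmax D' ⟨h, h'⟩⟩

theorem exists_eq_of_card_eq_three {S : Finset ι} {x y : ι} (h : S.card = 3) (hx : x ∈ S)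
    (hy : y ∈ S) (hxy : x ≠ y) : ∃ z, z ≠ x ∧ z ≠ y ∧ S = {x, y, z} := by
  have hy' : y ∈ S.erase x := Finset.mem_erase.2 ⟨hxy.symm, hy⟩
  have h1 : ((S.erase x).erase y).card = 1 := by
    rw [Finset.card_erase_of_mem hy', Finset.card_erase_of_mem hx, h]
  obtain ⟨z, hz⟩ := Finset.card_eq_one.1 h1
  have hz' : z ∈ (S.erase x).erase y := by simp [hz]
  simp only [Finset.mem_erase] at hz'
  exact ⟨z, hz'.2.1, hz'.1, by rw [← hz, Finset.insert_erase hy', Finset.insert_erase hx]⟩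

variable {F D : Finset (Finset ι)} {V : Finset ι}

/-- The exchange preserves the size, hence maximality. It yields a new set of free points to which
all trace restrictions apply again. -/
theorem MaxPacking.swap (hD : MaxPacking F D) {S T : Finset ι} (hT : T ∈ D) (hS : S ∈ F)
    (hSD : S ∉ D) (h : ∀ R ∈ D, R ≠ T → Disjoint S R) :
    MaxPacking F (insert S (D.erase T)) := by
  refine ⟨?_, ?_, fun D' h1 h2 => (hD.max D' h1 h2).trans ?_⟩
  · exact Finset.insert_subset hS ((Finset.erase_subset _ _).trans hD.subset)
  · intro P hP Q hQ hPQ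
    simp only [Finset.mem_insert, Finset.mem_erase] at hP hQ
    rcases hP with rfl | hP <;> rcases hQ with rfl | hQ
    · exact absurd rfl hPQ
    · exact h Q hQ.2 hQ.1
    · exact (h P hP.2 hP.1).symm
    · exact hD.disjoint P hP.2 Q hQ.2 hPQ
  · rw [Finset.card_insert_of_notMem (fun h => hSD (Finset.mem_of_mem_erase h)),
      Finset.card_erase_of_mem hT]
    omega

/-- Disjoint triples are gadgets of ratio exactly 2/3, so restoring them one at a time preserves an
excess over two thirds. -/
theorem Tight.good_of_free (hF : Tight F V) (hDF : D ⊆ F)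
    (hdis : ∀ S ∈ D, ∀ T ∈ D, S ≠ T → Disjoint S T) (h : Good F (free V D)) : Good F V := by
  induction D using Finset.induction_on with
  | empty => simpa [free] using h
  | insert S D hSD ih =>
    have hSF : S ∈ F := hDF (by simp)
    refine ih ((Finset.subset_insert _ _).trans hDF)
      (fun P hP Q hQ => hdis P (by simp [hP]) Q (by simp [hQ])) ?_
    have hsub : S ⊆ free V D := by
      intro x hx
      refine mem_free.2 ⟨hF.subset S hSF hx, fun T hT hxT => ?_⟩
      have hST : S ≠ T := by rintro rfl; exact hSD hT
      exact Finset.disjoint_left.1 (hdis S (by simp) T (by simp [hT]) hST) hx hxT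
    have hint : S ∩ free V D = S := Finset.inter_eq_left.2 hsub
    have hfree : free V (insert S D) = free V D \ S := by
      ext x
      simp only [mem_free, Finset.mem_insert, forall_eq_or_imp, Finset.mem_sdiff]
      tauto
    rw [hfree] at h
    have hg := gadget_triple (V := free V D) hSF (by rw [hint]; exact hF.card_eq S hSF)
    rw [hint] at hg
    exact h.extend hg (by rw [hF.card_eq S hSF])

theorem Tight.not_good_free (hF : Tight F V) (hD : MaxPacking F D) : ¬ Good F (free V D) :=
  fun h => hF.not_good (hF.good_of_free hD.subset hD.disjoint h)

theorem Tight.cover_free (hF : Tight F V) : ∀ x ∈ free V D, ∃ S ∈ F, x ∈ S :=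
  fun x hx => hF.cover x (mem_free.1 hx).1

theorem Tight.not_gadget_free (hF : Tight F V) (hD : MaxPacking F D) {X : Finset ι} {k : ℕ}
    (hk : 2 * X.card < 3 * k) : ¬ Gadget F (free V D) X k :=
  fun h => hF.not_good_free hD (h.good hk hF.card_eq hF.cover_free)

/-- A one-point trace is a gadget of ratio 1, and a three-point trace would enlarge the packing. -/
theorem Tight.card_inter_free (hF : Tight F V) (hD : MaxPacking F D) {S : Finset ι}
    (hS : S ∈ F) {p : ι} (hpS : p ∈ S) (hp : p ∈ free V D) : (S ∩ free V D).card = 2 := by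
  have hpos : 0 < (S ∩ free V D).card := Finset.card_pos.2 ⟨p, by simp [hpS, hp]⟩
  have hle : (S ∩ free V D).card ≤ S.card := Finset.card_le_card Finset.inter_subset_left
  have h3 := hF.card_eq S hS
  have h1 : (S ∩ free V D).card ≠ 1 := fun h => by
    obtain ⟨x, hx⟩ := Finset.card_eq_one.1 h
    exact hF.not_gadget_free hD (by simp) (gadget_singleton hS hx)
  have hn3 : (S ∩ free V D).card ≠ 3 := fun h => by
    have hSU : S ⊆ free V D := Finset.inter_eq_left.1
      (Finset.eq_of_subset_of_card_le Finset.inter_subset_left (by omega))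
    have hdis : ∀ T ∈ D, Disjoint S T := fun T hT =>
      Finset.disjoint_left.2 fun x hx => (mem_free.1 (hSU hx)).2 T hT
    have hSD : S ∉ D := fun h => (mem_free.1 hp).2 S h hpS
    have := hD.max (insert S D) (Finset.insert_subset hS hD.subset) (by
      intro P hP Q hQ hPQ
      simp only [Finset.mem_insert] at hP hQ
      rcases hP with rfl | hP <;> rcases hQ with rfl | hQ
      · exact absurd rfl hPQ
      · exact hdis Q hQ
      · exact (hdis P hP).symm
      · exact hD.disjoint P hP Q hQ hPQ)
    rw [Finset.card_insert_of_notMem hSD] at this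
    omega
  omega

theorem Tight.exists_other (hF : Tight F V) (hD : MaxPacking F D) {S : Finset ι}
    (hS : S ∈ F) {p : ι} (hpS : p ∈ S) (hp : p ∈ free V D) :
    ∃ q, p ≠ q ∧ S ∩ free V D = {p, q} := by
  obtain ⟨x, y, hxy, h⟩ := Finset.card_eq_two.1 (hF.card_inter_free hD hS hpS hp)
  have : p ∈ S ∩ free V D := by simp [hp, hpS]
  rw [h, Finset.mem_insert, Finset.mem_singleton] at this
  rcases this with rfl | rfl
  · exact ⟨y, hxy, h⟩
  · exact ⟨x, hxy.symm, by rw [h, Finset.pair_comm]⟩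

theorem Tight.exists_eq (hF : Tight F V) (hD : MaxPacking F D) {S : Finset ι}
    (hS : S ∈ F) {p : ι} (hpS : p ∈ S) (hp : p ∈ free V D) :
    ∃ a q, S = {a, p, q} ∧ q ∈ free V D ∧ p ≠ q := by
  obtain ⟨q, hpq, h⟩ := hF.exists_other hD hS hpS hp
  have hq : q ∈ S ∩ free V D := by simp [h]
  rw [Finset.mem_inter] at hq
  obtain ⟨a, -, -, hSa⟩ := exists_eq_of_card_eq_three (hF.card_eq S hS) hpS hq.1 hpq
  refine ⟨a, q, ?_, hq.2, hpq⟩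
  rw [hSa]; ext x; simp only [Finset.mem_insert, Finset.mem_singleton]; tauto

theorem Tight.ne_of_mem (hF : Tight F V) {a p q : ι} (hS : {a, p, q} ∈ F) :
    a ≠ p ∧ a ≠ q ∧ p ≠ q := by
  have h := hF.card_eq _ hS
  have h2 : ∀ x y : ι, ({x, y} : Finset ι).card ≠ 3 := fun x y => by
    have := Finset.card_le_two (a := x) (b := y)
    omega
  refine ⟨?_, ?_, ?_⟩ <;> rintro rfl
  · exact h2 a q (by simpa using h)
  · exact h2 p a (by rwa [Finset.insert_eq_of_mem (by simp)] at h)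
  · exact h2 a p (by simpa using h)

theorem Tight.notMem_free (hF : Tight F V) (hD : MaxPacking F D) {a p q : ι}
    (hS : {a, p, q} ∈ F) (hp : p ∈ free V D) (hq : q ∈ free V D) : a ∉ free V D := by
  intro ha
  have h := hF.card_inter_free hD hS (by simp) hp
  rw [Finset.inter_eq_left.2 (by simp [Finset.insert_subset_iff, *]), hF.card_eq _ hS] at h
  omega

theorem Tight.inter_free (hF : Tight F V) (hD : MaxPacking F D) {a p q : ι}
    (hS : {a, p, q} ∈ F) (hp : p ∈ free V D) (hq : q ∈ free V D) :
    {a, p, q} ∩ free V D = {p, q} := by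
  rw [Finset.insert_inter_of_notMem (hF.notMem_free hD hS hp hq),
    Finset.inter_eq_left.2 (by simp [Finset.insert_subset_iff, *])]

/-- Two members of a tight family share at most one point. -/
theorem Tight.eq_of_mem (hF : Tight F V) {S R : Finset ι} (hS : S ∈ F) (hR : R ∈ F) {x y : ι}
    (hxy : x ≠ y) (hxS : x ∈ S) (hyS : y ∈ S) (hxR : x ∈ R) (hyR : y ∈ R) : S = R := by
  obtain ⟨c, hcx, hcy, rfl⟩ := exists_eq_of_card_eq_three (hF.card_eq S hS) hxS hyS hxy
  obtain ⟨d, hdx, hdy, rfl⟩ := exists_eq_of_card_eq_three (hF.card_eq R hR) hxR hyR hxy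
  by_contra hne
  have hcd : c ≠ d := by rintro rfl; exact hne rfl
  -- Two triples sharing a pair light three of four points, a ratio above 2/3.
  refine hF.not_good ((gadget_two_triples hS hR (hF.subset _ hS) (hF.subset _ hR) hxy hcx.symm
    hdx.symm hcy.symm hdy.symm hcd).good ?_ hF.card_eq hF.cover)
  have := Finset.card_le_four (a := x) (b := y) (c := c) (d := d)
  omega

/-- The trace of a member of `F` on the free points is adjacent to another trace. -/
theorem Tight.exists_adjacent (hF : Tight F V) (hD : MaxPacking F D) {a p q : ι}
    (hS : {a, p, q} ∈ F) (hp : p ∈ free V D) (hq : q ∈ free V D) :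
    ∃ p' q' r b, (p' = p ∧ q' = q ∨ p' = q ∧ q' = p) ∧ {b, q', r} ∈ F ∧ r ∈ free V D ∧
      r ≠ p' ∧ r ≠ q' := by
  have hpq := (hF.ne_of_mem hS).2.2
  have ht : ¬ ∀ R ∈ F, (p ∈ R ↔ q ∈ R) := fun ht =>
    hF.not_gadget_free hD (by rw [Finset.card_pair hpq]; norm_num)
      (gadget_twins hS (hF.inter_free hD hS hp hq) hpq ht)
  push Not at ht
  obtain ⟨R, hR, h | h⟩ := ht
  · obtain ⟨b, r, rfl, hr, hpr⟩ := hF.exists_eq hD hR h.1 hp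
    exact ⟨q, p, r, b, by simp, hR, hr, by rintro rfl; simp at h, hpr.symm⟩
  · obtain ⟨b, r, rfl, hr, hqr⟩ := hF.exists_eq hD hR h.2 hq
    exact ⟨p, q, r, b, by simp, hR, hr, by rintro rfl; simp at h, hqr.symm⟩

/-- Traces on the free points span components of exactly three points. -/
theorem Tight.component (hF : Tight F V) (hD : MaxPacking F D) {a p q b r : ι}
    (hS : {a, p, q} ∈ F) (hR : {b, q, r} ∈ F) (hp : p ∈ free V D) (hq : q ∈ free V D)
    (hr : r ∈ free V D) (hpr : p ≠ r) {Q : Finset ι} (hQ : Q ∈ F) {x : ι} (hxQ : x ∈ Q)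
    (hx : x = p ∨ x = q ∨ x = r) {s : ι} (hsQ : s ∈ Q) (hs : s ∈ free V D) :
    s = p ∨ s = q ∨ s = r := by
  by_contra hne
  push Not at hne
  have hxU : x ∈ free V D := by rcases hx with rfl | rfl | rfl <;> assumption
  have hxs : x ≠ s := by rintro rfl; tauto
  have hQU : Q ∩ free V D = {x, s} := by
    refine (Finset.eq_of_subset_of_card_le (by simp [Finset.insert_subset_iff, *]) ?_).symm
    rw [hF.card_inter_free hD hQ hxQ hxU, Finset.card_pair hxs]
  refine hF.not_gadget_free hD ?_ (gadget_tree hS hR hQ (hF.inter_free hD hS hp hq)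
    (hF.inter_free hD hR hq hr) hQU hx (hF.ne_of_mem hS).2.2 (hF.ne_of_mem hR).2.2 hpr
    hne.1 hne.2.1 hne.2.2)
  have := Finset.card_le_four (a := p) (b := q) (c := r) (d := s)
  omega

theorem MaxPacking.eq_of_mem (hD : MaxPacking F D) {S T : Finset ι} (hS : S ∈ D) (hT : T ∈ D)
    {x : ι} (hxS : x ∈ S) (hxT : x ∈ T) : S = T := by
  by_contra h
  exact Finset.disjoint_left.1 (hD.disjoint S hS T hT h) hxS hxT

theorem MaxPacking.swap_triple (hD : MaxPacking F D) {T : Finset ι} (hT : T ∈ D) {a p q : ι}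
    (ha : a ∈ T) (hS : {a, p, q} ∈ F) (hp : p ∈ free V D) (hq : q ∈ free V D) :
    MaxPacking F (insert {a, p, q} (D.erase T)) := by
  refine hD.swap hT hS (fun h => (mem_free.1 hp).2 _ h (by simp)) fun R hR hRT => ?_
  rw [Finset.disjoint_left]
  intro x hx hxR
  simp only [Finset.mem_insert, Finset.mem_singleton] at hx
  rcases hx with rfl | rfl | rfl
  · exact hRT (hD.eq_of_mem hR hT hxR ha)
  · exact (mem_free.1 hp).2 _ hR hxR
  · exact (mem_free.1 hq).2 _ hR hxR

theorem mem_free_swap_of_mem_free {S T : Finset ι} {x : ι} (hx : x ∈ free V D) (hxS : x ∉ S) :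
    x ∈ free V (insert S (D.erase T)) := by
  simp only [mem_free, Finset.mem_insert, Finset.mem_erase] at hx ⊢
  refine ⟨hx.1, ?_⟩
  rintro R (rfl | hR)
  · exact hxS
  · exact hx.2 R hR.2

theorem mem_free_swap_of_mem (hF : Tight F V) (hD : MaxPacking F D) {S T : Finset ι} {x : ι}
    (hT : T ∈ D) (hx : x ∈ T) (hxS : x ∉ S) : x ∈ free V (insert S (D.erase T)) := by
  simp only [mem_free, Finset.mem_insert, Finset.mem_erase]
  refine ⟨hF.subset T (hD.subset hT) hx, ?_⟩
  rintro R (rfl | hR)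
  · exact hxS
  · exact fun hxR => hR.1 (hD.eq_of_mem hR.2 hT hxR hx)

theorem mem_of_mem_free_swap {S T : Finset ι} {x : ι}
    (hx : x ∈ free V (insert S (D.erase T))) (hxU : x ∉ free V D) : x ∈ T ∧ x ∉ S := by
  simp only [mem_free, Finset.mem_insert, Finset.mem_erase, forall_eq_or_imp] at hx hxU
  refine ⟨?_, hx.2.1⟩
  by_contra hxT
  exact hxU ⟨hx.1, fun R hR hxR => hx.2.2 R ⟨by rintro rfl; exact hxT hxR, hR⟩ hxR⟩

/-- Members of `F` with adjacent traces meet the same member of the packing, in different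
points. -/
theorem Tight.mem_of_adjacent (hF : Tight F V) (hD : MaxPacking F D) {T : Finset ι} (hT : T ∈ D)
    {a p q b r : ι} (ha : a ∈ T) (hS : {a, p, q} ∈ F) (hR : {b, q, r} ∈ F)
    (hp : p ∈ free V D) (hq : q ∈ free V D) (hr : r ∈ free V D) (hpr : p ≠ r) :
    b ∈ T ∧ b ≠ a := by
  have hD' := hD.swap_triple hT ha hS hp hq
  have hqr := (hF.ne_of_mem hR).2.2
  have hra : r ≠ a := by rintro rfl; exact hF.notMem_free hD hS hp hq hr
  -- After the exchange `r` is still free but `q` is not. The trace of `{b, q, r}` must still be a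
  -- pair, so `b` has become free, that is, `b` lies in `T` and differs from `a`.
  have hr' : r ∈ free V (insert {a, p, q} (D.erase T)) :=
    mem_free_swap_of_mem_free hr (by simp [hra, hpr.symm, hqr.symm])
  obtain ⟨y, hry, hy⟩ := hF.exists_other hD' hR (by simp) hr'
  have hyR : y ∈ ({b, q, r} : Finset ι) ∩ free V (insert {a, p, q} (D.erase T)) := by simp [hy]
  simp only [Finset.mem_inter, Finset.mem_insert, Finset.mem_singleton] at hyR
  obtain ⟨rfl | rfl | rfl, hyU⟩ := hyR
  · have := mem_of_mem_free_swap hyU (hF.notMem_free hD hR hq hr)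
    exact ⟨this.1, fun h => this.2 (by simp [h])⟩
  · exact absurd (by simp) ((mem_free.1 hyU).2 {a, p, y} (by simp))
  · exact absurd rfl hry

/-- Two components cannot be attached to the same point of a member of the packing. -/
theorem Tight.not_attached (hF : Tight F V) (hD : MaxPacking F D) {T : Finset ι} (hT : T ∈ D)
    {a p q p' q' b' r' : ι} (ha : a ∈ T) (hS : {a, p, q} ∈ F) (hp : p ∈ free V D)
    (hq : q ∈ free V D) (hS' : {a, p', q'} ∈ F) (hR' : {b', q', r'} ∈ F)
    (hp' : p' ∈ free V D) (hq' : q' ∈ free V D) (hr' : r' ∈ free V D) (hpr' : p' ≠ r')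
    (h1 : p' ≠ p ∧ p' ≠ q) (h2 : q' ≠ p ∧ q' ≠ q) (h3 : r' ≠ p ∧ r' ≠ q) : False := by
  have hb := hF.mem_of_adjacent hD hT ha hS' hR' hp' hq' hr' hpr'
  have hD' := hD.swap_triple hT ha hS hp hq
  have haU := hF.notMem_free hD hS hp hq
  have key : ∀ {x}, x ∈ free V D → x ≠ p ∧ x ≠ q → x ∈ free V (insert {a, p, q} (D.erase T)) := by
    intro x hx hxne
    have : x ≠ a := by rintro rfl; exact haU hx
    exact mem_free_swap_of_mem_free hx (by simp [this, hxne])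
  -- The second component is untouched by the exchange, so `b'` lies in both `T` and `{a, p, q}`.
  -- These meet only in `a`, yet `b' ≠ a`.
  have hb' := (hF.mem_of_adjacent hD' (T := {a, p, q}) (by simp) (by simp) hS' hR' (key hp' h1)
    (key hq' h2) (key hr' h3) hpr').1
  simp only [Finset.mem_insert, Finset.mem_singleton] at hb'
  rcases hb' with rfl | rfl | rfl
  · exact hb.2 rfl
  · exact (mem_free.1 hp).2 T hT hb.1
  · exact (mem_free.1 hq).2 T hT hb.1

/-- Exchanging `T` for `{a, p, q}` frees `x`, so `Q` has a second free point, necessarily released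
from `T`. Then `Q` and `T` share two points and coincide. -/
theorem Tight.eq_of_disjoint_free (hF : Tight F V) (hD : MaxPacking F D) {T : Finset ι}
    (hT : T ∈ D) {a p q x : ι} (ha : a ∈ T) (hS : {a, p, q} ∈ F) (hp : p ∈ free V D)
    (hq : q ∈ free V D) {Q : Finset ι} (hQ : Q ∈ F) (hQU : ∀ y ∈ Q, y ∉ free V D)
    (hxQ : x ∈ Q) (hxT : x ∈ T) (hxa : x ≠ a) : Q = T := by
  have hD' := hD.swap_triple hT ha hS hp hq
  have hne : ∀ {y}, y ∈ free V D → x ≠ y := by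
    rintro y hy rfl
    exact (mem_free.1 hy).2 T hT hxT
  have hx' := mem_free_swap_of_mem (S := {a, p, q}) hF hD hT hxT (by simp [hxa, hne hp, hne hq])
  obtain ⟨z, hxz, hz⟩ := hF.exists_other hD' hQ hxQ hx'
  have hzQ : z ∈ Q ∩ free V (insert {a, p, q} (D.erase T)) := by simp [hz]
  rw [Finset.mem_inter] at hzQ
  exact hF.eq_of_mem hQ (hD.subset hT) hxz hxQ hzQ.1 hxT
    (mem_of_mem_free_swap hzQ.2 (hQU z hzQ.1)).1

/-- A member of `F` through two points of a component meets the member of the packing to which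
the component is attached. -/
theorem Tight.mem_of_component (hF : Tight F V) (hD : MaxPacking F D) {T : Finset ι} (hT : T ∈ D)
    {a b p q r d y z : ι} (ha : a ∈ T) (hb : b ∈ T) (hS : {a, p, q} ∈ F) (hR : {b, q, r} ∈ F)
    (hp : p ∈ free V D) (hq : q ∈ free V D) (hr : r ∈ free V D) (hQ : {d, y, z} ∈ F)
    (hy : y = p ∨ y = q ∨ y = r) (hz : z = p ∨ z = q ∨ z = r) : d ∈ T := by
  have e0 : ∀ e u v, e ∈ T → {e, u, v} ∈ F → {d, u, v} ∈ F → d ∈ T := by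
    intro e u v he h h'
    have hne := hF.ne_of_mem h'
    have hm : d ∈ ({e, u, v} : Finset ι) := by
      rw [← hF.eq_of_mem h' h hne.2.2 (by simp) (by simp) (by simp) (by simp)]
      simp
    simp only [Finset.mem_insert, Finset.mem_singleton, hne.1, hne.2.1, or_false] at hm
    exact hm ▸ he
  have e1 : {d, p, r} ∈ F → d ∈ T := fun h => (hF.mem_of_adjacent hD hT ha
    (by rwa [Finset.pair_comm q p]) h hq hp hr (hF.ne_of_mem hR).2.2).1
  have hyz := (hF.ne_of_mem hQ).2.2
  have hQ' : {d, z, y} ∈ F := by rwa [Finset.pair_comm z y]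
  rcases hy with rfl | rfl | rfl <;> rcases hz with rfl | rfl | rfl
  · exact absurd rfl hyz
  · exact e0 _ _ _ ha hS hQ
  · exact e1 hQ
  · exact e0 _ _ _ ha hS hQ'
  · exact absurd rfl hyz
  · exact e0 _ _ _ hb hR hQ
  · exact e1 hQ'
  · exact e0 _ _ _ hb hR hQ'
  · exact absurd rfl hyz

/-- No second component is attached to a member of the packing. -/
theorem Tight.not_attached_of_notMem (hF : Tight F V) (hD : MaxPacking F D)
    {a b c p q r d y z : ι} (hT : {a, b, c} ∈ D) (hS : {a, p, q} ∈ F) (hR : {b, q, r} ∈ F)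
    (hp : p ∈ free V D) (hq : q ∈ free V D) (hr : r ∈ free V D) (hpr : p ≠ r)
    (hQ : {d, y, z} ∈ F) (hy : y ∈ free V D) (hz : z ∈ free V D) (hd : d = a ∨ d = b ∨ d = c)
    (hyX : y ≠ p ∧ y ≠ q ∧ y ≠ r) (hzX : z ≠ p ∧ z ≠ q ∧ z ≠ r) : False := by
  obtain ⟨p', q', r', b', hpq', hR', hr', hrp', hrq'⟩ := hF.exists_adjacent hD hQ hy hz
  have hall : {d, p', q'} ∈ F ∧ p' ∈ free V D ∧ q' ∈ free V D ∧
      (p' ≠ p ∧ p' ≠ q ∧ p' ≠ r) ∧ (q' ≠ p ∧ q' ≠ q ∧ q' ≠ r) := by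
    rcases hpq' with ⟨rfl, rfl⟩ | ⟨rfl, rfl⟩
    · exact ⟨hQ, hy, hz, hyX, hzX⟩
    · exact ⟨by rwa [Finset.pair_comm p' q'], hz, hy, hzX, hyX⟩
  clear hQ hy hz hyX hzX hpq'
  obtain ⟨hQ', hp', hq', np', nq'⟩ := hall
  have nr' : r' ≠ p ∧ r' ≠ q ∧ r' ≠ r := by
    by_contra h
    have h' : r' = p ∨ r' = q ∨ r' = r := by
      by_contra h'
      push Not at h'
      exact h h'
    rcases hF.component hD hS hR hp hq hr hpr hR' (x := r') (by simp) h'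
      (s := q') (by simp) hq' with h | h | h
    · exact nq'.1 h
    · exact nq'.2.1 h
    · exact nq'.2.2 h
  have hb' := hF.mem_of_adjacent hD hT (by simpa using hd) hQ' hR' hp' hq' hr' hrp'.symm
  have key : ∀ {e u v w f}, e = a ∨ e = b → {e, u, v} ∈ F → {f, v, w} ∈ F →
      u ∈ free V D → v ∈ free V D → w ∈ free V D → u ≠ w →
      (u ≠ p ∧ u ≠ q ∧ u ≠ r) → (v ≠ p ∧ v ≠ q ∧ v ≠ r) → (w ≠ p ∧ w ≠ q ∧ w ≠ r) →
      False := by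
    rintro e u v w f (rfl | rfl) h1 h2 hu hv hw huw nu nv nw
    · exact hF.not_attached hD hT (by simp) hS hp hq h1 h2 hu hv hw huw ⟨nu.1, nu.2.1⟩
        ⟨nv.1, nv.2.1⟩ ⟨nw.1, nw.2.1⟩
    · exact hF.not_attached hD hT (by simp) hR hq hr h1 h2 hu hv hw huw nu.2 nv.2 nw.2
  have hab : d = a ∨ d = b → False := fun h =>
    key h hQ' hR' hp' hq' hr' hrp'.symm np' nq' nr'
  rcases hd with hd | hd | hd
  · exact hab (Or.inl hd)
  · exact hab (Or.inr hd)
  -- Here the first triple is attached at `c`; its neighbour is attached at `a` or `b`, so the path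
  -- is read backwards.
  · obtain ⟨hbT, hbd⟩ := hb'
    simp only [Finset.mem_insert, Finset.mem_singleton, ← hd, hbd, or_false] at hbT
    exact key hbT (by rwa [Finset.pair_comm r' q']) (by rwa [Finset.pair_comm q' p'])
      hr' hq' hp' hrp' nr' nq' np'

/-- A member of the packing together with a component attached to it is a union of connected
components of `F`. -/
theorem Tight.closed (hF : Tight F V) (hD : MaxPacking F D) {a b c p q r : ι}
    (hT : {a, b, c} ∈ D) (hS : {a, p, q} ∈ F) (hR : {b, q, r} ∈ F)
    (hp : p ∈ free V D) (hq : q ∈ free V D) (hr : r ∈ free V D) (hpr : p ≠ r)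
    {Q : Finset ι} (hQ : Q ∈ F) {x : ι} (hxQ : x ∈ Q)
    (hx : x ∈ ({a, b, c} : Finset ι) ∪ {p, q, r}) : Q ⊆ {a, b, c} ∪ {p, q, r} := by
  have hab := (hF.ne_of_mem (hD.subset hT)).1
  have hTU : ∀ y ∈ ({a, b, c} : Finset ι), y ∉ free V D := fun y hy hyU =>
    (mem_free.1 hyU).2 _ hT hy
  have hpqrU : ∀ y ∈ ({p, q, r} : Finset ι), y ∈ free V D := by
    simp [hp, hq, hr]
  by_cases hQU : ∃ y ∈ Q, y ∈ free V D
  · obtain ⟨y, hyQ, hy⟩ := hQU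
    obtain ⟨d, z, rfl, hz, hyz⟩ := hF.exists_eq hD hQ hyQ hy
    by_cases hin : (y = p ∨ y = q ∨ y = r) ∨ (z = p ∨ z = q ∨ z = r)
    · have hy' : y = p ∨ y = q ∨ y = r := by
        rcases hin with h | h
        · exact h
        · exact hF.component hD hS hR hp hq hr hpr hQ (by simp) h hyQ hy
      have hz' : z = p ∨ z = q ∨ z = r :=
        hF.component hD hS hR hp hq hr hpr hQ hyQ hy' (by simp) hz
      have hd := hF.mem_of_component hD hT (by simp) (by simp) hS hR hp hq hr hQ hy' hz'
      intro w hw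
      simp only [Finset.mem_insert, Finset.mem_singleton] at hw
      rw [Finset.mem_union]
      rcases hw with rfl | rfl | rfl
      · exact Or.inl hd
      · right; simpa using hy'
      · right; simpa using hz'
    · exfalso
      push Not at hin
      refine hF.not_attached_of_notMem hD hT hS hR hp hq hr hpr hQ hy hz ?_ hin.1 hin.2
      have hy' : y ∉ ({p, q, r} : Finset ι) := by simpa using hin.1
      have hz' : z ∉ ({p, q, r} : Finset ι) := by simpa using hin.2
      rw [Finset.mem_union] at hx
      simp only [Finset.mem_insert (b := d), Finset.mem_insert (b := y),
        Finset.mem_singleton] at hxQ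
      rcases hx with hx | hx
      · rcases hxQ with rfl | rfl | rfl
        · simpa using hx
        · exact absurd hy (hTU _ hx)
        · exact absurd hz (hTU _ hx)
      · rcases hxQ with rfl | rfl | rfl
        · exact absurd (hpqrU _ hx) (hF.notMem_free hD hQ hy hz)
        · exact absurd hx hy'
        · exact absurd hx hz'
  · push Not at hQU
    have hxT : x ∈ ({a, b, c} : Finset ι) := by
      rcases Finset.mem_union.1 hx with h | h
      · exact h
      · exact absurd (hpqrU x h) (hQU x hxQ)
    have hQT : Q = {a, b, c} := by
      -- The exchange must release `x`: use the triple at `a`, or the one at `b` when `x = a`.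
      by_cases hxa : x = a
      · exact hF.eq_of_disjoint_free hD hT (by simp) hR hq hr hQ hQU hxQ hxT
          (by rw [hxa]; exact hab)
      · exact hF.eq_of_disjoint_free hD hT (by simp) hS hp hq hQ hQU hxQ hxT hxa
    rw [hQT]
    exact Finset.subset_union_left

theorem Good.mono {F G : Finset (Finset ι)} (hFG : F ⊆ G) (h : Good F V) : Good G V := by
  obtain ⟨c, hc, h⟩ := h
  exact ⟨c, hc.mono hFG, h⟩

/-- If the packing covered `V`, omitting one triple would leave exactly its three points free, and
one toggle would light them all. -/
theorem Tight.free_nonempty (hF : Tight F V) (hV : V.Nonempty) (hD : MaxPacking F D) :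
    (free V D).Nonempty := by
  by_contra hU
  rw [Finset.not_nonempty_iff_eq_empty] at hU
  obtain ⟨x, hx⟩ := hV
  have hx' : x ∉ free V D := by simp [hU]
  obtain ⟨T, hT, hxT⟩ : ∃ T ∈ D, x ∈ T := by
    by_contra h
    push Not at h
    exact hx' (mem_free.2 ⟨hx, h⟩)
  have hsub : free V (D.erase T) ⊆ T := by
    intro y hy
    by_contra hyT
    have : y ∈ free V D := by
      rw [mem_free] at hy ⊢
      refine ⟨hy.1, fun R hR hyR => hy.2 R (Finset.mem_erase.2 ⟨?_, hR⟩) hyR⟩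
      rintro rfl; exact hyT hyR
    simp [hU] at this
  have hxm : x ∈ free V (D.erase T) := mem_free.2 ⟨hx, fun R hR hxR =>
    (Finset.mem_erase.1 hR).1 (hD.eq_of_mem (Finset.mem_erase.1 hR).2 hT hxR hxT)⟩
  refine hF.not_good (hF.good_of_free (D := D.erase T)
    ((Finset.erase_subset _ _).trans hD.subset)
    (fun P hP Q hQ => hD.disjoint P (Finset.mem_of_mem_erase hP) Q (Finset.mem_of_mem_erase hQ))
    ⟨_, Lit.empty.step (hD.subset hT), ?_⟩)
  have hpos : 0 < (free V (D.erase T)).card := Finset.card_pos.2 ⟨x, hxm⟩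
  have he : symmDiff ∅ T ∩ free V (D.erase T) = free V (D.erase T) := by
    rw [Finset.inter_eq_right]
    intro y hy
    simp [Finset.mem_symmDiff, hsub hy]
  rw [he]
  omega

theorem Tight.six_dvd_card (hF : Tight F V) : 6 ∣ V.card := by
  induction hn : V.card using Nat.strong_induction_on generalizing V F with
  | _ n ih =>
  subst hn
  rcases V.eq_empty_or_nonempty with rfl | hV
  · simp
  obtain ⟨D, hD⟩ := exists_maxPacking F
  obtain ⟨p₀, hp₀⟩ := hF.free_nonempty hV hD
  obtain ⟨S, hS, hpS⟩ := hF.cover_free p₀ hp₀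
  obtain ⟨a, q₀, rfl, hq₀, -⟩ := hF.exists_eq hD hS hpS hp₀
  obtain ⟨p, q, r, b, hpq, hR, hr, hrp, hrq⟩ := hF.exists_adjacent hD hS hp₀ hq₀
  have hall : {a, p, q} ∈ F ∧ p ∈ free V D ∧ q ∈ free V D := by
    rcases hpq with ⟨rfl, rfl⟩ | ⟨rfl, rfl⟩
    · exact ⟨hS, hp₀, hq₀⟩
    · exact ⟨by rwa [Finset.pair_comm p q], hq₀, hp₀⟩
  clear hS hpS hpq hp₀ hq₀
  obtain ⟨hS, hp, hq⟩ := hall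
  obtain ⟨T, hT, haT⟩ : ∃ T ∈ D, a ∈ T := by
    by_contra h
    push Not at h
    exact hF.notMem_free hD hS hp hq (mem_free.2 ⟨hF.subset _ hS (by simp), h⟩)
  obtain ⟨hbT, hba⟩ := hF.mem_of_adjacent hD hT haT hS hR hp hq hr hrp.symm
  obtain ⟨c, -, -, rfl⟩ := exists_eq_of_card_eq_three (hF.card_eq T (hD.subset hT)) haT hbT
    hba.symm
  have hcl := fun Q hQ x hxQ hx =>
    hF.closed hD hT hS hR hp hq hr hrp.symm (Q := Q) hQ (x := x) hxQ hx
  have hTF := hD.subset hT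
  have hUT : ∀ y ∈ free V D, y ∉ ({a, b, c} : Finset ι) := fun y hy => (mem_free.1 hy).2 _ hT
  have hpqr : ({p, q, r} : Finset ι).card = 3 := Finset.card_eq_three.2
    ⟨p, q, r, (hF.ne_of_mem hS).2.2, hrp.symm, hrq.symm, rfl⟩
  have hdisj : Disjoint ({a, b, c} : Finset ι) {p, q, r} := by
    rw [Finset.disjoint_right]
    intro y hy
    simp only [Finset.mem_insert, Finset.mem_singleton] at hy
    rcases hy with rfl | rfl | rfl
    · exact hUT _ hp
    · exact hUT _ hq
    · exact hUT _ hr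
  have hUV : free V D ⊆ V := Finset.sdiff_subset
  set X : Finset ι := {a, b, c} ∪ {p, q, r} with hX
  have hXcard : X.card = 6 := by
    rw [hX, Finset.card_union_of_disjoint hdisj, hF.card_eq _ hTF, hpqr]
  have hXV : X ⊆ V := Finset.union_subset (hF.subset _ hTF)
    (by simp [Finset.insert_subset_iff, hUV hp, hUV hq, hUV hr])
  have hcard := Finset.card_sdiff_add_card_eq_card hXV
  have htight : Tight (F.filter fun S => S ⊆ V \ X) (V \ X) := by
    refine ⟨fun S hS => hF.card_eq S (Finset.mem_filter.1 hS).1,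
      fun S hS => (Finset.mem_filter.1 hS).2, fun x hx => ?_, fun hg => hF.not_good ?_⟩
    · rw [Finset.mem_sdiff] at hx
      obtain ⟨Q, hQ, hxQ⟩ := hF.cover x hx.1
      refine ⟨Q, Finset.mem_filter.2 ⟨hQ, fun y hy => ?_⟩, hxQ⟩
      exact Finset.mem_sdiff.2 ⟨hF.subset Q hQ hy, fun hyX => hx.2 (hcl Q hQ y hy hyX hxQ)⟩
    · have hg1 : Good F (V \ X) := hg.mono (Finset.filter_subset _ _)
      have hVX : V \ X = (V \ {a, b, c}) \ {p, q, r} := by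
        rw [hX, sdiff_sdiff_left]; rfl
      rw [hVX] at hg1
      have trace : ∀ {d u v}, {d, u, v} ∈ F → d ∈ ({a, b, c} : Finset ι) → u ∈ free V D →
          v ∈ free V D → {d, u, v} ∩ (V \ {a, b, c}) = {u, v} := by
        intro d u v _ hd hu hv
        rw [Finset.insert_inter_of_notMem (by simp only [Finset.mem_sdiff]; tauto)]
        refine Finset.inter_eq_left.2 ?_
        intro w hw
        simp only [Finset.mem_insert, Finset.mem_singleton] at hw
        rw [Finset.mem_sdiff]
        rcases hw with rfl | rfl
        · exact ⟨hUV hu, hUT _ hu⟩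
        · exact ⟨hUV hv, hUT _ hv⟩
      -- The block is restored in two gadgets of ratio 2/3. The path comes first: its triples reduce
      -- to pairs only while `{a, b, c}` is absent.
      have hg2 : Good F (V \ {a, b, c}) := hg1.extend
        (gadget_path hS hR (trace hS haT hp hq) (trace hR hbT hq hr) (hF.ne_of_mem hS).2.2
          hrp.symm) (by rw [hpqr])
      have hTV : {a, b, c} ∩ V = {a, b, c} := Finset.inter_eq_left.2 (hF.subset _ hTF)
      have hgT := gadget_triple (V := V) hTF (by rw [hTV]; exact hF.card_eq _ hTF)
      rw [hTV] at hgT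
      exact hg2.extend hgT (by rw [hF.card_eq _ hTF])
  have := ih _ (by omega) htight rfl
  omega

end Tight

/-! ### Disjoint unions and explicit wirings: upper bounds -/

theorem le_maxLit {n : ℕ} (W : Matrix (Fin n) (Fin n) (ZMod 2)) (x : Fin n → ZMod 2) :
    hammingNorm (W.mulVec x) ≤ maxLit W 0 := by
  have := Finset.le_sup (f := fun x : Fin n → ZMod 2 => hammingNorm (W.mulVec x + 0))
    (Finset.mem_univ x)
  simpa [maxLit] using this

theorem hammingNorm_fin_add {n m : ℕ} (y : Fin (n + m) → ZMod 2) :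
    hammingNorm y = hammingNorm (fun i => y (Fin.castAdd m i)) +
      hammingNorm (fun i => y (Fin.natAdd n i)) := by
  simp only [hammingNorm, Finset.card_filter, Fin.sum_univ_add]

/-- The disjoint union of two wirings. -/
def blockSum {n m : ℕ} (W : Matrix (Fin n) (Fin n) (ZMod 2))
    (W' : Matrix (Fin m) (Fin m) (ZMod 2)) : Matrix (Fin (n + m)) (Fin (n + m)) (ZMod 2) :=
  Matrix.reindex finSumFinEquiv finSumFinEquiv (Matrix.fromBlocks W 0 0 W')

section blockSum

variable {n m : ℕ} (W : Matrix (Fin n) (Fin n) (ZMod 2)) (W' : Matrix (Fin m) (Fin m) (ZMod 2))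

theorem blockSum_diag (h : ∀ i, W i i = 1) (h' : ∀ i, W' i i = 1) (i : Fin (n + m)) :
    blockSum W W' i i = 1 := by
  refine Fin.addCases (fun i => ?_) (fun i => ?_) i <;> simp [blockSum, h, h']

theorem vertexDegree_blockSum_castAdd (j : Fin n) :
    vertexDegree (blockSum W W') (Fin.castAdd m j) = vertexDegree W j := by
  rw [vertexDegree, hammingNorm_fin_add]
  simp [blockSum, vertexDegree, hammingNorm]

theorem vertexDegree_blockSum_natAdd (j : Fin m) :
    vertexDegree (blockSum W W') (Fin.natAdd n j) = vertexDegree W' j := by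
  rw [vertexDegree, hammingNorm_fin_add]
  simp [blockSum, vertexDegree, hammingNorm]

theorem maxLit_blockSum_le : maxLit (blockSum W W') 0 ≤ maxLit W 0 + maxLit W' 0 := by
  refine Finset.sup_le fun x _ => ?_
  rw [add_zero, hammingNorm_fin_add]
  refine add_le_add (le_trans (le_of_eq ?_) (le_maxLit W fun i => x (Fin.castAdd m i)))
    (le_trans (le_of_eq ?_) (le_maxLit W' fun i => x (Fin.natAdd n i)))
  · congr 1; ext i
    simp [Matrix.mulVec, dotProduct, Fin.sum_univ_add, blockSum]
  · congr 1; ext i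
    simp [Matrix.mulVec, dotProduct, Fin.sum_univ_add, blockSum]

end blockSum

theorem degree_le_iff {n m : ℕ} {W : Matrix (Fin n) (Fin n) (ZMod 2)} :
    degree W ≤ m ↔ ∀ j, vertexDegree W j ≤ m := by
  simp [degree]

theorem blockSum_mem_A {n n' m : ℕ} {W : Matrix (Fin n) (Fin n) (ZMod 2)}
    {W' : Matrix (Fin n') (Fin n') (ZMod 2)} (h : W ∈ A n m) (h' : W' ∈ A n' m) :
    blockSum W W' ∈ A (n + n') m := by
  refine ⟨blockSum_diag W W' h.1 h'.1, degree_le_iff.2 fun j => ?_⟩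
  refine Fin.addCases (fun j => ?_) (fun j => ?_) j
  · rw [vertexDegree_blockSum_castAdd]; exact degree_le_iff.1 h.2 j
  · rw [vertexDegree_blockSum_natAdd]; exact degree_le_iff.1 h'.2 j

theorem blockSum_mem_AStar {n n' m : ℕ} {W : Matrix (Fin n) (Fin n) (ZMod 2)}
    {W' : Matrix (Fin n') (Fin n') (ZMod 2)} (h : W ∈ AStar n m) (h' : W' ∈ AStar n' m) :
    blockSum W W' ∈ AStar (n + n') m := by
  refine ⟨blockSum_mem_A h.1 h'.1, fun j => ?_⟩
  refine Fin.addCases (fun j => ?_) (fun j => ?_) j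
  · rw [vertexDegree_blockSum_castAdd]; exact h.2 j
  · rw [vertexDegree_blockSum_natAdd]; exact h'.2 j

theorem mu_le {n m : ℕ} {W : Matrix (Fin n) (Fin n) (ZMod 2)} (h : W ∈ A n m) :
    mu n m ≤ maxLit W 0 := Nat.sInf_le ⟨W, h, rfl⟩

theorem muStar_le {n m : ℕ} {W : Matrix (Fin n) (Fin n) (ZMod 2)} (h : W ∈ AStar n m) :
    muStar n m ≤ maxLit W 0 := Nat.sInf_le ⟨W, h, rfl⟩

theorem mu_add_le {n n' m : ℕ} (hm : 1 ≤ m) : mu (n + n') m ≤ mu n m + mu n' m := by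
  obtain ⟨W, hW, h⟩ := (isLeast_mu (n := n) hm).1
  obtain ⟨W', hW', h'⟩ := (isLeast_mu (n := n') hm).1
  rw [← h, ← h']
  exact (mu_le (blockSum_mem_A hW hW')).trans (maxLit_blockSum_le W W')

theorem muStar_add_le {n n' m : ℕ} (hm : 1 ≤ m) (hn : m ≤ n) (hn' : m ≤ n') :
    muStar (n + n') m ≤ muStar n m + muStar n' m := by
  obtain ⟨W, hW, h⟩ := (isLeast_muStar hm hn).1
  obtain ⟨W', hW', h'⟩ := (isLeast_muStar hm hn').1
  rw [← h, ← h']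
  exact (muStar_le (blockSum_mem_AStar hW hW')).trans (maxLit_blockSum_le W W')

theorem mu_le_muStar {n m : ℕ} (hm : 1 ≤ m) (hn : m ≤ n) : mu n m ≤ muStar n m := by
  obtain ⟨W, hW, h⟩ := (isLeast_muStar hm hn).1
  rw [← h]
  exact mu_le hW.1

theorem mu_anti {n m m' : ℕ} (hm : 1 ≤ m) (h : m ≤ m') : mu n m' ≤ mu n m := by
  obtain ⟨W, hW, hl⟩ := (isLeast_mu (n := n) hm).1
  rw [← hl]
  exact mu_le ⟨hW.1, hW.2.trans h⟩

theorem mu_le_self {n m : ℕ} (hm : 1 ≤ m) : mu n m ≤ n := by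
  obtain ⟨W, hW⟩ := A_nonempty (n := n) hm
  refine (mu_le hW).trans (Finset.sup_le fun x _ => ?_)
  exact hammingNorm_le_card_fintype.trans (Fintype.card_fin n).le

theorem muStar_le_self {n m : ℕ} (hm : 1 ≤ m) (hn : m ≤ n) : muStar n m ≤ n := by
  obtain ⟨W, hW⟩ := AStar_nonempty hm hn
  refine (muStar_le hW).trans (Finset.sup_le fun x _ => ?_)
  exact hammingNorm_le_card_fintype.trans (Fintype.card_fin n).le

/-- All columns have even weight, so the three bulbs are never all lit. -/
theorem mu_three_two_le : mu 3 2 ≤ 2 := by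
  have h : (!![1, 0, 1; 1, 1, 0; 0, 1, 1] : Matrix (Fin 3) (Fin 3) (ZMod 2)) ∈ A 3 2 :=
    ⟨by decide, degree_le_iff.2 (by decide)⟩
  exact (mu_le h).trans (Finset.sup_le (by decide))

theorem muStar_le_of {n m M : ℕ} (W : Matrix (Fin n) (Fin n) (ZMod 2)) (h : ∀ i, W i i = 1)
    (hd : ∀ j, vertexDegree W j = m) (hM : ∀ x, hammingNorm (W.mulVec x) ≤ M) :
    muStar n m ≤ M :=
  (muStar_le ⟨⟨h, degree_le_iff.2 fun j => (hd j).le⟩, hd⟩).trans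
    (Finset.sup_le fun x _ => by simpa using hM x)

theorem muStar_four_three_le : muStar 4 3 ≤ 3 :=
  muStar_le_of !![1, 0, 0, 0; 0, 1, 1, 1; 1, 1, 1, 1; 1, 1, 1, 1]
    (by decide) (by decide) (by decide +kernel)

theorem muStar_five_three_le : muStar 5 3 ≤ 4 :=
  muStar_le_of !![1, 1, 1, 0, 0; 1, 1, 1, 0, 0; 1, 1, 1, 1, 1; 0, 0, 0, 1, 1; 0, 0, 0, 1, 1]
    (by decide) (by decide) (by decide +kernel)

/-- The cut space of the complete graph on four vertices. -/
theorem muStar_six_three_le : muStar 6 3 ≤ 4 :=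
  muStar_le_of !![1, 0, 0, 0, 0, 1; 0, 1, 0, 1, 0, 0; 0, 0, 1, 0, 1, 0;
      0, 1, 1, 1, 1, 0; 1, 0, 1, 0, 1, 1; 1, 1, 0, 1, 0, 1]
    (by decide) (by decide) (by decide +kernel)

/-- Counting from 1, bulbs 1, 2, 4 always sum to zero, and so do bulbs 5, 6, 7. At most two of each
group are lit, together with bulb 3. -/
theorem muStar_seven_three_le : muStar 7 3 ≤ 5 :=
  muStar_le_of !![1, 0, 0, 0, 0, 0, 0; 0, 1, 1, 1, 0, 0, 0; 1, 1, 1, 1, 1, 1, 1;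
      1, 1, 1, 1, 0, 0, 0; 0, 0, 0, 0, 1, 0, 1; 0, 0, 0, 0, 1, 1, 0; 0, 0, 0, 0, 0, 1, 1]
    (by decide) (by decide) (by decide +kernel)

theorem mu_two_le (n : ℕ) : mu n 2 ≤ (2 * n + 2) / 3 := by
  induction n using Nat.strong_induction_on with
  | _ n ih =>
  by_cases h : n < 3
  · have := mu_le_self (n := n) (m := 2) (by norm_num)
    omega
  · obtain ⟨k, rfl⟩ : ∃ k, n = k + 3 := ⟨n - 3, by omega⟩
    have := ih k (by omega)
    have := mu_add_le (n := k) (n' := 3) (m := 2) (by norm_num)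
    have := mu_three_two_le
    omega

theorem muStar_three_le (n : ℕ) (hn : 3 ≤ n) :
    muStar n 3 ≤ (2 * n + 2) / 3 + if n % 6 = 3 then 1 else 0 := by
  induction n using Nat.strong_induction_on with
  | _ n ih =>
  by_cases h : n < 9
  · have h8 := muStar_add_le (n := 4) (n' := 4) (m := 3) (by norm_num) (by norm_num) (by norm_num)
    norm_num at h8
    have h4 := muStar_four_three_le
    have h5 := muStar_five_three_le
    have h6 := muStar_six_three_le
    have h7 := muStar_seven_three_le
    have h3 := muStar_le_self (n := 3) (m := 3) (by norm_num) le_rfl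
    interval_cases n <;> norm_num <;> omega
  -- Adding the six-bulb wiring costs 4, exactly two thirds of 6, and keeps the residue mod 6; the
  -- correction term stems from `n = 3`.
  · obtain ⟨k, rfl⟩ : ∃ k, n = k + 6 := ⟨n - 6, by omega⟩
    have hk := ih k (by omega) (by omega)
    have := muStar_add_le (n := k) (n' := 6) (m := 3) (by norm_num) (by omega) (by norm_num)
    have := muStar_six_three_le
    have hmod : (k + 6) % 6 = k % 6 := by omega
    rw [hmod]
    split_ifs at hk ⊢ <;> omega

/-! ### From families of sets back to wirings: lower bounds -/

/-- The set of bulbs toggled by button `j`. -/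
def column {n : ℕ} (W : Matrix (Fin n) (Fin n) (ZMod 2)) (j : Fin n) : Finset (Fin n) :=
  Finset.univ.filter fun i => W i j ≠ 0

theorem card_column {n : ℕ} (W : Matrix (Fin n) (Fin n) (ZMod 2)) (j : Fin n) :
    (column W j).card = vertexDegree W j := rfl

theorem Lit.exists_mulVec {n : ℕ} {W : Matrix (Fin n) (Fin n) (ZMod 2)} {c : Finset (Fin n)}
    (hc : Lit (Finset.univ.image (column W)) c) :
    ∃ x, ∀ i, i ∈ c ↔ W.mulVec x i ≠ 0 := by
  induction hc with
  | empty => exact ⟨0, by simp⟩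
  | step _ hS ih =>
    obtain ⟨x, hx⟩ := ih
    obtain ⟨j, -, rfl⟩ := Finset.mem_image.1 hS
    refine ⟨x + Pi.single j 1, fun i => ?_⟩
    have key : ∀ u v : ZMod 2, u + v ≠ 0 ↔ u ≠ 0 ∧ ¬ v ≠ 0 ∨ v ≠ 0 ∧ ¬ u ≠ 0 := by decide
    rw [Finset.mem_symmDiff, hx, Matrix.mulVec_add, Pi.add_apply, key]
    simp [column]

theorem Lit.card_le_maxLit {n : ℕ} {W : Matrix (Fin n) (Fin n) (ZMod 2)} {c : Finset (Fin n)}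
    (hc : Lit (Finset.univ.image (column W)) c) : c.card ≤ maxLit W 0 := by
  obtain ⟨x, hx⟩ := hc.exists_mulVec
  refine le_trans (le_of_eq ?_) (le_maxLit W x)
  rw [hammingNorm]
  congr 1
  ext i
  simp [hx]

theorem mem_column_self {n m : ℕ} {W : Matrix (Fin n) (Fin n) (ZMod 2)} (hW : W ∈ A n m)
    (i : Fin n) : i ∈ column W i := by
  simp [column, hW.1 i]

theorem two_mul_le_three_mul_maxLit {n : ℕ} {W : Matrix (Fin n) (Fin n) (ZMod 2)}
    (hW : W ∈ A n 3) : 2 * n ≤ 3 * maxLit W 0 := by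
  obtain ⟨c, hc, h⟩ := exists_lit_two_thirds (F := Finset.univ.image (column W)) Finset.univ
    (fun S hS => by
      obtain ⟨j, -, rfl⟩ := Finset.mem_image.1 hS
      rw [Finset.inter_univ, card_column]
      exact degree_le_iff.1 hW.2 j)
    (fun i _ => ⟨column W i, by simp, mem_column_self hW i⟩)
  rw [Finset.card_fin, Finset.inter_univ] at h
  have := hc.card_le_maxLit
  omega

theorem two_mul_lt_three_mul_maxLit {n : ℕ} {W : Matrix (Fin n) (Fin n) (ZMod 2)}
    (hW : W ∈ AStar n 3) (hn : ¬ 6 ∣ n) : 2 * n < 3 * maxLit W 0 := by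
  by_contra hlt
  have hT : Tight (Finset.univ.image (column W)) Finset.univ := by
    refine ⟨fun S hS => ?_, fun _ _ => Finset.subset_univ _,
      fun i _ => ⟨column W i, by simp, mem_column_self hW.1 i⟩, ?_⟩
    · obtain ⟨j, -, rfl⟩ := Finset.mem_image.1 hS
      rw [card_column, hW.2 j]
    · rintro ⟨c, hc, h⟩
      rw [Finset.card_fin, Finset.inter_univ] at h
      have := hc.card_le_maxLit
      omega
  have := hT.six_dvd_card
  rw [Finset.card_fin] at this
  exact hn this

theorem two_mul_le_three_mul_mu (n : ℕ) : 2 * n ≤ 3 * mu n 3 := by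
  obtain ⟨W, hW, h⟩ := (isLeast_mu (n := n) (m := 3) (by norm_num)).1
  rw [← h]
  exact two_mul_le_three_mul_maxLit hW

theorem two_mul_lt_three_mul_muStar {n : ℕ} (h3 : 3 ≤ n) (hn : ¬ 6 ∣ n) :
    2 * n < 3 * muStar n 3 := by
  obtain ⟨W, hW, h⟩ := (isLeast_muStar (n := n) (m := 3) (by norm_num) h3).1
  rw [← h]
  exact two_mul_lt_three_mul_maxLit hW hn

theorem ceil_two_thirds (n : ℕ) : ⌈(2 * (n : ℚ)) / 3⌉₊ = (2 * n + 2) / 3 := by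
  refine le_antisymm (Nat.ceil_le.2 ?_) ?_
  · rw [div_le_iff₀ (by norm_num)]
    exact_mod_cast (by omega : 2 * n ≤ (2 * n + 2) / 3 * 3)
  · have h := Nat.le_ceil ((2 * (n : ℚ)) / 3)
    rw [div_le_iff₀ (by norm_num)] at h
    have h' : 2 * n ≤ ⌈(2 * (n : ℚ)) / 3⌉₊ * 3 := by exact_mod_cast h
    omega

end Wiring

theorem theorem2 (n : ℕ) (hn : 1 ≤ n) :
    (Wiring.mu n 3 = Wiring.mu n 2 ∧ Wiring.mu n 2 = ⌈(2 * (n : ℚ)) / 3⌉₊) ∧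
    (3 ≤ n →
      (∀ k : ℕ, 1 ≤ k → n = 6 * k - 3 →
        Wiring.muStar n 3 = 4 * k - 1 ∧ Wiring.muStar n 3 = Wiring.mu n 3 + 1) ∧
      ((¬ ∃ k : ℕ, 1 ≤ k ∧ n = 6 * k - 3) → Wiring.muStar n 3 = Wiring.mu n 3)) := by
  have h1 := Wiring.two_mul_le_three_mul_mu n
  have h2 := Wiring.mu_anti (n := n) (m := 2) (m' := 3) (by norm_num) (by norm_num)
  have h3 := Wiring.mu_two_le n
  rw [Wiring.ceil_two_thirds]
  refine ⟨⟨by omega, by omega⟩, fun hn3 => ?_⟩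
  have h4 := Wiring.mu_le_muStar (n := n) (m := 3) (by norm_num) hn3
  have h5 := Wiring.muStar_three_le n hn3
  refine ⟨fun k hk hnk => ?_, fun hk => ?_⟩
  -- As `n` is an odd multiple of 3, `2n/3 = 4k - 2` is an integer, and strictness forces `4k - 1`.
  · have h6 := Wiring.two_mul_lt_three_mul_muStar hn3 (by omega)
    rw [if_pos (by omega)] at h5
    omega
  · have h7 : n % 6 ≠ 3 := fun h => hk ⟨n / 6 + 1, by omega, by omega⟩
    rw [if_neg h7] at h5
    omega
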